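/- Let $d\ge 1$ be an integer, $0<\alpha<d$ and $1<r<p<\infty$ (in particular the case $\alpha\le r$, $p\le d$ is covered). There is a constant $N>0$, depending only on $\alpha,d,r,p$, such that the following holds. Let $A$ be a real number and let $b\ge 0$ be a measurable function on $\mathbb R^d$ such that for every $\rho>0$ and every open ball $B\subset\mathbb R^d$ of radius $\rho$ the function $b^p$ is integrable on $B$ and $$\Big(\frac1{|B|}\int_B b^p\,dx\Big)^{1/p}\le A\rho^{-\alpha}.$$ Let $f\in L_r(\mathbb R^d)$ be real-valued and let $$R_\alpha f(x)=\int_{\mathbb R^d}\frac{f(x+y)}{|y|^{d-\alpha}}\,dy$$ be its Riesz potential. Then the integral defining $R_\alpha f(x)$ converges absolutely for almost every $x$ with $b(x)\neq0$, the function $b^r|R_\alpha f|^r$ (understood as $0$ where $b=0$) is integrable, and $$\int_{\mathbb R^d} b^r|R_\alpha f|^r\,dx\le N A^r\int_{\mathbb R^d}|f|^r\,dx .$$ -/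

import Mathlib

open MeasureTheory

/-- The kernel integrand `y ↦ f (x + y) / |y| ^ (d - α)` of the Riesz potential at `x`. -/
noncomputable def rieszIntegrand {d : ℕ} (α : ℝ) (f : EuclideanSpace ℝ (Fin d) → ℝ)
    (x y : EuclideanSpace ℝ (Fin d)) : ℝ :=
  f (x + y) / ‖y‖ ^ ((d : ℝ) - α)

/-- The Riesz potential `R_α f (x) = ∫ f (x + y) / |y| ^ (d - α) dy` on `ℝ^d`. -/
noncomputable def rieszPotential {d : ℕ} (α : ℝ) (f : EuclideanSpace ℝ (Fin d) → ℝ)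
    (x : EuclideanSpace ℝ (Fin d)) : ℝ :=
  ∫ y, rieszIntegrand α f x y

/-- The Morrey-type bound: `b ^ p` is integrable on every ball `B` of every radius `ρ > 0`, and
`(|B|⁻¹ ∫_B b ^ p) ^ (1 / p) ≤ A ρ ^ (-α)`. -/
def MorreyBound {d : ℕ} (p α A : ℝ) (b : EuclideanSpace ℝ (Fin d) → ℝ) : Prop :=
  ∀ (z : EuclideanSpace ℝ (Fin d)) (ρ : ℝ), 0 < ρ →
    IntegrableOn (fun x => b x ^ p) (Metric.ball z ρ) volume ∧
      (⨍ x in Metric.ball z ρ, b x ^ p) ^ (1 / p) ≤ A * ρ ^ (-α)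

/-!
The proof is Schur's test with powers of a single weight. Put `w = M (b ^ p)`, with `M` the
uncentred Hardy–Littlewood maximal function, so that `b ≤ w ^ (1 / p)` almost everywhere by Lebesgue
differentiation.

For `1 / p < δ < 1` the weight `w ^ δ` satisfies the pointwise bound
`R_α (w ^ δ) ≤ C * A * w ^ (δ - 1 / p)` (`exists_potential_maximalFunction_rpow_le`).
Indeed `|y| ^ (α - d)` is a superposition of indicators of balls, so `R_α (w ^ δ) (x)` is controlled
by the integrals of `w ^ δ` over the balls `B (x, ρ)`. For small `ρ` the average of `w ^ δ` over
`B (x, ρ)` is at most `C * w x ^ δ`, the `A₁` property of Coifman and Rochberg; for large `ρ` it is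
at most `C * (A * ρ ^ (-α)) ^ (p * δ)`, by the Morrey bound. Both estimates are instances of
`exists_setLIntegral_maximalFunction_rpow_le`, which follows from the weak type `(1, 1)` of `M` and
Kolmogorov's inequality. The small radii converge because `α > 0`, the large ones because
`p * δ > 1`, and the best splitting radius gives the stated power of `w x`.

Now choose `t` slightly larger than `r` and let `τ = (t - 1) / (r - 1)`, so that `t / p` and `τ / p`
both lie in `(1 / p, 1)`. Hölder's inequality with the test function `φ` for which
`φ ^ (r / (r - 1)) = w ^ (τ / p)` and `φ ^ r = w ^ ((t - 1) / p)` gives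
`b ^ r * (R_α f) ^ r ≤ (C * A) ^ (r - 1) * w ^ (t / p) * R_α (φ ^ (-r) * f ^ r)`. After integration
the symmetric operator `R_α` moves onto `w ^ (t / p)`, and the pointwise bound with `δ = t / p`
cancels the factor `φ ^ (-r)` (`lintegral_mul_rpow_le_of_schur`). All estimates are made for
nonnegative functions with values in `[0, ∞]`; the absolute convergence of the Riesz potential where
`b ≠ 0` and the integrability are read off from the finiteness of the result.
-/

open Metric Set Filter Topology
open scoped ENNReal NNReal

/-! ### Kolmogorov's inequality -/

/-- Kolmogorov's inequality: a weak-type bound on the level sets of `h` above the height `l` bounds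
the integral of `h ^ δ`, for `δ < 1`. -/
theorem exists_lintegral_rpow_le_of_weakType {X : Type*} [MeasurableSpace X] {δ : ℝ}
    (hδ0 : 0 < δ) (hδ1 : δ < 1) {C₀ : ℝ≥0∞} (hC₀ : C₀ ≠ ∞) :
    ∃ C : ℝ≥0∞, C ≠ ∞ ∧ ∀ (ν : Measure X) (h : X → ℝ≥0∞), Measurable h →
      ∀ l : ℝ≥0∞, l ≠ 0 → l ≠ ∞ →
      (∀ s, l ≤ s → s ≠ ∞ → s * ν {x | s < h x} ≤ C₀ * l * ν univ) →
      ∫⁻ x, h x ^ δ ∂ν ≤ C * l ^ δ * ν univ := by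
  set a : ℝ≥0∞ := 2 ^ (δ - 1) with ha
  have ha1 : a < 1 := ENNReal.rpow_lt_one_of_one_lt_of_neg (by norm_num) (by linarith)
  refine ⟨1 + 2 ^ δ * C₀ * (1 - a)⁻¹, ?_, ?_⟩
  · refine ENNReal.add_ne_top.2 ⟨by simp, ENNReal.mul_ne_top (ENNReal.mul_ne_top ?_ hC₀) ?_⟩
    · exact ENNReal.rpow_ne_top_of_nonneg hδ0.le (by norm_num)
    · exact ENNReal.inv_ne_top.2 (tsub_pos_of_lt ha1).ne'
  intro ν h hh l hl0 hlt hweak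
  have hlδ0 : l ^ δ ≠ 0 := by simp [hl0, hlt]
  have hset : ∀ k : ℕ, MeasurableSet {x | 2 ^ k * l < h x} := fun k =>
    measurableSet_lt measurable_const hh
  -- Dyadic decomposition into the level sets at the heights `2 ^ k * l`; where `h = ∞` the series
  -- diverges.
  have hpt : ∀ x, h x ^ δ ≤ l ^ δ + ∑' k : ℕ,
      {x | 2 ^ k * l < h x}.indicator (fun _ => (2 ^ (k + 1) * l) ^ δ) x := by
    intro x
    rcases eq_or_ne (h x) ∞ with hx | hx
    · have : ∑' k : ℕ, {x | 2 ^ k * l < h x}.indicator (fun _ => (2 ^ (k + 1) * l) ^ δ) x = ∞ := by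
        refine top_le_iff.1 ?_
        rw [← ENNReal.tsum_const_eq_top_of_ne_zero (α := ℕ) hlδ0]
        refine ENNReal.tsum_le_tsum fun k => ?_
        rw [indicator_of_mem]
        · refine ENNReal.rpow_le_rpow ?_ hδ0.le
          exact le_mul_of_one_le_left zero_le (one_le_pow₀ (by norm_num))
        · simp only [mem_ofPred_eq, hx]
          exact ENNReal.mul_lt_top (by simp) hlt.lt_top
      simp [this]
    · have hex : ∃ n : ℕ, h x ≤ 2 ^ n * l := by
        obtain ⟨n, hn⟩ := ENNReal.exists_nat_gt (ENNReal.div_ne_top hx hl0)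
        refine ⟨n, ?_⟩
        rw [← ENNReal.div_le_iff hl0 hlt]
        refine hn.le.trans ?_
        exact_mod_cast Nat.lt_two_pow_self.le
      classical
      have hfind := Nat.find_spec hex
      rcases hn : Nat.find hex with _ | k
      · rw [hn] at hfind
        simp only [pow_zero, one_mul] at hfind
        exact (ENNReal.rpow_le_rpow hfind hδ0.le).trans le_self_add
      · have hk : 2 ^ k * l < h x := not_le.1 (Nat.find_min hex (by omega))
        rw [hn] at hfind
        refine le_trans ?_ (le_trans (ENNReal.le_tsum k) le_add_self)
        rw [indicator_of_mem (by exact hk)]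
        exact ENNReal.rpow_le_rpow hfind hδ0.le
  calc ∫⁻ x, h x ^ δ ∂ν
      ≤ ∫⁻ x, (l ^ δ + ∑' k : ℕ,
          {x | 2 ^ k * l < h x}.indicator (fun _ => (2 ^ (k + 1) * l) ^ δ) x) ∂ν :=
        lintegral_mono hpt
    _ = l ^ δ * ν univ + ∑' k : ℕ, (2 ^ (k + 1) * l) ^ δ * ν {x | 2 ^ k * l < h x} := by
        rw [lintegral_add_left measurable_const, lintegral_const,
          lintegral_tsum fun k => (measurable_const.indicator (hset k)).aemeasurable]
        congr 1
        exact tsum_congr fun k => lintegral_indicator_const (hset k) _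
    _ ≤ l ^ δ * ν univ + ∑' k : ℕ, a ^ k * (2 ^ δ * C₀ * l ^ δ * ν univ) := by
        refine add_le_add le_rfl (ENNReal.tsum_le_tsum fun k => ?_)
        have h2k0 : (2 : ℝ≥0∞) ^ k ≠ 0 := by simp
        have h2kt : (2 : ℝ≥0∞) ^ k ≠ ∞ := by simp
        have hw := hweak (2 ^ k * l) (le_mul_of_one_le_left zero_le
          (one_le_pow₀ (by norm_num))) (ENNReal.mul_ne_top h2kt hlt)
        have hw' : ν {x | 2 ^ k * l < h x} ≤ (2 ^ k)⁻¹ * (C₀ * ν univ) := by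
          rw [← ENNReal.mul_le_iff_le_inv h2k0 h2kt,
            ← ENNReal.mul_le_mul_iff_right hl0 hlt]
          calc _ = _ := by ring
            _ ≤ _ := hw
            _ = _ := by ring
        have hpow : (2 ^ (k + 1) * l) ^ δ * (2 ^ k)⁻¹ = a ^ k * 2 ^ δ * l ^ δ := by
          rw [ENNReal.mul_rpow_of_nonneg _ _ hδ0.le, pow_succ,
            ENNReal.mul_rpow_of_nonneg _ _ hδ0.le, ha, ENNReal.rpow_sub _ _ (by norm_num)
            (by norm_num), ENNReal.rpow_one, ENNReal.div_eq_inv_mul, mul_pow,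
            ← ENNReal.inv_pow, ← ENNReal.rpow_natCast, ← ENNReal.rpow_natCast,
            ← ENNReal.rpow_mul, ← ENNReal.rpow_mul, mul_comm δ]
          ring
        calc _ ≤ (2 ^ (k + 1) * l) ^ δ * ((2 ^ k)⁻¹ * (C₀ * ν univ)) := by gcongr
          _ = (2 ^ (k + 1) * l) ^ δ * (2 ^ k)⁻¹ * (C₀ * ν univ) := by ring
          _ = _ := by rw [hpow]; ring
    _ = _ := by
        rw [ENNReal.tsum_mul_right, ENNReal.tsum_geometric]
        ring

/-! ### The maximal function -/

section MaximalFunction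

variable {E : Type*} [NormedAddCommGroup E] [MeasurableSpace E]

/-- The uncentred Hardy–Littlewood maximal function: the supremum of the averages of `g` over all
open balls that contain `x`. Radii `σ ≤ 0` contribute nothing, because the ball is then empty. -/
noncomputable def maximalFunction (μ : Measure E) (g : E → ℝ≥0∞) (x : E) : ℝ≥0∞ :=
  ⨆ (z : E) (σ : ℝ), (ball z σ).indicator (fun _ => ⨍⁻ y in ball z σ, g y ∂μ) x

theorem lt_maximalFunction_iff {μ : Measure E} {g : E → ℝ≥0∞} {x : E} {s : ℝ≥0∞} :
    s < maximalFunction μ g x ↔ ∃ z σ, x ∈ ball z σ ∧ s < ⨍⁻ y in ball z σ, g y ∂μ := by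
  simp only [maximalFunction, lt_iSup_iff]
  refine exists₂_congr fun z σ => ?_
  by_cases hx : x ∈ ball z σ <;> simp [hx]

theorem setLAverage_le_maximalFunction {μ : Measure E} {g : E → ℝ≥0∞} {x z : E} {σ : ℝ}
    (hx : x ∈ ball z σ) : ⨍⁻ y in ball z σ, g y ∂μ ≤ maximalFunction μ g x := by
  refine le_trans (le_of_eq ?_) (le_iSup₂ z σ)
  rw [indicator_of_mem hx]

theorem measurable_maximalFunction [BorelSpace E] (μ : Measure E) (g : E → ℝ≥0∞) :
    Measurable (maximalFunction μ g) :=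
  (lowerSemicontinuous_iSup fun _ => lowerSemicontinuous_iSup fun _ =>
    isOpen_ball.lowerSemicontinuous_indicator zero_le).measurable

variable [NormedSpace ℝ E] [FiniteDimensional ℝ E] (μ : Measure E) [μ.IsAddHaarMeasure]

theorem setLIntegral_ball_le_maximalFunction (g : E → ℝ≥0∞) (x : E) {σ : ℝ} (hσ : 0 < σ) :
    ∫⁻ y in ball x σ, g y ∂μ ≤ maximalFunction μ g x * μ (ball x σ) := by
  rw [← measure_mul_setLAverage g measure_ball_lt_top.ne, mul_comm]
  gcongr
  exact setLAverage_le_maximalFunction (mem_ball_self hσ)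

variable [BorelSpace E]

theorem measure_ball_mul_eq (x z : E) (σ : ℝ) {c : ℝ} (hc : 0 < c) :
    μ (ball x (c * σ)) = ENNReal.ofReal (c ^ Module.finrank ℝ E) * μ (ball z σ) := by
  rw [Measure.addHaar_ball_mul_of_pos μ x hc, Measure.addHaar_ball_center μ z]

variable [Nontrivial E]

/-- The maximal function is of weak type `(1, 1)`, by the Vitali covering lemma. -/
theorem mul_measure_lt_maximalFunction_le (g : E → ℝ≥0∞) {s : ℝ≥0∞} (hs : s ≠ ∞) :
    s * μ {x | s < maximalFunction μ g x} ≤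
      ENNReal.ofReal (5 ^ Module.finrank ℝ E) * ∫⁻ x, g x ∂μ := by
  rcases eq_or_ne s 0 with rfl | hs0
  · simp
  set G := ∫⁻ x, g x ∂μ with hG
  rcases eq_or_ne G ∞ with hGt | hGt
  · rw [hGt, ENNReal.mul_top (by positivity)]
    exact le_top
  set T : Set (E × ℝ) := {q | 0 < q.2 ∧ s * μ (ball q.1 q.2) < ∫⁻ y in ball q.1 q.2, g y ∂μ} with hT
  have hω0 : μ (ball (0 : E) 1) ≠ 0 := (measure_ball_pos μ _ one_pos).ne'
  have hωt : μ (ball (0 : E) 1) ≠ ∞ := measure_ball_lt_top.ne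
  have hd : Module.finrank ℝ E ≠ 0 := Module.finrank_pos.ne'
  -- The radii are bounded, since the integral of `g` over the whole space is finite.
  have hR : ∀ q ∈ T, q.2 ≤ max 1 (G / (s * μ (ball (0 : E) 1))).toReal := by
    rintro ⟨z, σ⟩ ⟨h0, h⟩
    simp only at h0 h
    by_contra! hcon
    rw [max_lt_iff] at hcon
    have h1 : s * μ (ball z σ) ≤ G := h.le.trans (setLIntegral_le_lintegral _ _)
    rw [Measure.addHaar_ball_of_pos μ z h0] at h1
    have h2 : ENNReal.ofReal (σ ^ Module.finrank ℝ E) ≤ G / (s * μ (ball (0 : E) 1)) := by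
      rw [ENNReal.le_div_iff_mul_le (Or.inl (mul_ne_zero hs0 hω0))
        (Or.inl (ENNReal.mul_ne_top hs hωt))]
      calc _ = _ := by ring
        _ ≤ _ := h1
    have h3 := (ENNReal.ofReal_le_iff_le_toReal
      (ENNReal.div_ne_top hGt (mul_ne_zero hs0 hω0))).1 h2
    have h4 : σ ≤ σ ^ Module.finrank ℝ E := le_self_pow₀ hcon.1.le hd
    linarith [hcon.2]
  obtain ⟨u, huT, hdis, hcov⟩ := Vitali.exists_disjoint_subfamily_covering_enlargement_closedBall
    T (fun q => q.1) (fun q => q.2) _ hR 5 (by norm_num)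
  have hdis' : u.PairwiseDisjoint fun q => ball q.1 q.2 := fun a ha b hb hab =>
    (hdis ha hb hab).mono ball_subset_closedBall ball_subset_closedBall
  have hcount : u.Countable := hdis'.countable_of_isOpen (fun _ _ => isOpen_ball)
    fun q hq => ⟨q.1, mem_ball_self (huT hq).1⟩
  have hsub : {x | s < maximalFunction μ g x} ⊆ ⋃ q ∈ u, closedBall q.1 (5 * q.2) := by
    intro x hx
    obtain ⟨z, σ, hxz, hlt⟩ := lt_maximalFunction_iff.1 hx
    have hσ : 0 < σ := pos_of_mem_ball hxz
    have hmem : (z, σ) ∈ T := by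
      refine ⟨hσ, ?_⟩
      rw [← measure_mul_setLAverage g measure_ball_lt_top.ne, mul_comm]
      exact (ENNReal.mul_lt_mul_iff_right (measure_ball_pos μ z hσ).ne'
        measure_ball_lt_top.ne).2 hlt
    obtain ⟨q, hq, hsub⟩ := hcov _ hmem
    exact mem_biUnion hq (hsub (ball_subset_closedBall hxz))
  have := hcount.to_subtype
  calc s * μ {x | s < maximalFunction μ g x}
      ≤ s * ∑' q : u, μ (closedBall q.1.1 (5 * q.1.2)) := by
        gcongr
        exact (measure_mono hsub).trans (measure_biUnion_le μ hcount _)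
    _ = ENNReal.ofReal (5 ^ Module.finrank ℝ E) * ∑' q : u, s * μ (ball q.1.1 q.1.2) := by
        rw [← ENNReal.tsum_mul_left, ← ENNReal.tsum_mul_left]
        refine tsum_congr fun q => ?_
        rw [Measure.addHaar_closedBall_eq_addHaar_ball, measure_ball_mul_eq μ _ q.1.1 _ (by norm_num)]
        ring
    _ ≤ ENNReal.ofReal (5 ^ Module.finrank ℝ E) *
          ∑' q : u, ∫⁻ y in ball q.1.1 q.1.2, g y ∂μ := by
        gcongr with q
        exact (huT q.2).2.le
    _ = ENNReal.ofReal (5 ^ Module.finrank ℝ E) * ∫⁻ y in ⋃ q ∈ u, ball q.1 q.2, g y ∂μ := by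
        rw [lintegral_biUnion hcount (fun _ _ => measurableSet_ball) hdis']
    _ ≤ _ := by
        gcongr
        exact setLIntegral_le_lintegral _ _

/-- If the averages of `g` over the balls of radius at least `ρ` about `x` are at most `m`, then
the average of `(M g) ^ δ` over the ball of radius `ρ` is at most a multiple of `m ^ δ`. For
`m = M g x` this is the `A₁` property of `(M g) ^ δ` (Coifman–Rochberg). -/
theorem exists_setLIntegral_maximalFunction_rpow_le {δ : ℝ} (hδ0 : 0 < δ) (hδ1 : δ < 1) :
    ∃ C : ℝ≥0∞, C ≠ ∞ ∧ ∀ (g : E → ℝ≥0∞) (x : E) (ρ : ℝ) (m : ℝ≥0∞), 0 < ρ → m ≠ 0 → m ≠ ∞ →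
      (∀ σ, ρ ≤ σ → ∫⁻ y in ball x σ, g y ∂μ ≤ m * μ (ball x σ)) →
      ∫⁻ y in ball x ρ, maximalFunction μ g y ^ δ ∂μ ≤ C * m ^ δ * μ (ball x ρ) := by
  set D := Module.finrank ℝ E with hD
  obtain ⟨C, hC, H⟩ := exists_lintegral_rpow_le_of_weakType (X := E) hδ0 hδ1
    (C₀ := ENNReal.ofReal (5 ^ D)) (by simp)
  set c : ℝ≥0∞ := ENNReal.ofReal (3 ^ D) with hc
  have hc0 : c ≠ 0 := by simp [hc]
  have hct : c ≠ ∞ := by simp [hc]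
  refine ⟨C * c ^ δ, ENNReal.mul_ne_top hC (ENNReal.rpow_ne_top_of_nonneg hδ0.le hct), ?_⟩
  intro g x ρ m hρ hm0 hmt hm
  have key := H (μ.restrict (ball x ρ)) (maximalFunction μ g) (measurable_maximalFunction μ g)
    (c * m) (mul_ne_zero hc0 hm0) (ENNReal.mul_ne_top hct hmt) ?_
  · rw [ENNReal.mul_rpow_of_nonneg _ _ hδ0.le, Measure.restrict_apply_univ] at key
    calc _ ≤ _ := key
      _ = _ := by ring
  intro s hs hst
  set g₁ := (ball x (3 * ρ)).indicator g with hg₁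
  -- Only balls of radius less than `ρ` can have an average above `3 ^ D * m`, and those that meet
  -- `ball x ρ` lie inside `ball x (3 * ρ)`.
  have hsub : {y | s < maximalFunction μ g y} ∩ ball x ρ ⊆ {y | s < maximalFunction μ g₁ y} := by
    rintro y ⟨hy, hyx⟩
    obtain ⟨z, σ, hyz, hlt⟩ := lt_maximalFunction_iff.1 hy
    have hσ : 0 < σ := pos_of_mem_ball hyz
    rw [mem_ball] at hyz hyx
    have hzx : dist z x < σ + ρ := by
      linarith [dist_triangle z y x, dist_comm z y]
    refine lt_maximalFunction_iff.2 ⟨z, σ, hyz, ?_⟩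
    rcases le_or_gt σ ρ with hle | hlt'
    · convert hlt using 1
      refine setLAverage_congr_fun measurableSet_ball fun v hv => ?_
      refine indicator_of_mem ?_ g
      rw [mem_ball] at hv ⊢
      linarith [dist_triangle v z x]
    · exfalso
      refine hlt.not_ge (le_trans ?_ hs)
      rw [setLAverage_eq, ENNReal.div_le_iff (measure_ball_pos μ z hσ).ne' measure_ball_lt_top.ne]
      calc ∫⁻ v in ball z σ, g v ∂μ ≤ ∫⁻ v in ball x (3 * σ), g v ∂μ :=
            lintegral_mono_set (ball_subset_ball' (by linarith))
        _ ≤ m * μ (ball x (3 * σ)) := hm _ (by linarith)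
        _ = _ := by
          rw [measure_ball_mul_eq μ x z σ (by norm_num)]
          ring
  calc s * μ.restrict (ball x ρ) {y | s < maximalFunction μ g y}
      ≤ s * μ {y | s < maximalFunction μ g₁ y} := by
        rw [Measure.restrict_apply
          (measurableSet_lt measurable_const (measurable_maximalFunction μ g))]
        gcongr
    _ ≤ ENNReal.ofReal (5 ^ D) * ∫⁻ v, g₁ v ∂μ := mul_measure_lt_maximalFunction_le μ g₁ hst
    _ ≤ ENNReal.ofReal (5 ^ D) * (m * μ (ball x (3 * ρ))) := by
        gcongr
        rw [hg₁, lintegral_indicator measurableSet_ball]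
        exact hm _ (by linarith)
    _ = _ := by
        rw [measure_ball_mul_eq μ x x ρ (by norm_num), Measure.restrict_apply_univ]
        ring

/-- Lebesgue differentiation: a nonnegative locally integrable function is dominated by its maximal
function. -/
theorem ae_ofReal_le_maximalFunction {g : E → ℝ} (hg : LocallyIntegrable g μ)
    (hg0 : ∀ x, 0 ≤ g x) :
    ∀ᵐ x ∂μ, ENNReal.ofReal (g x) ≤ maximalFunction μ (fun y => ENNReal.ofReal (g y)) x := by
  filter_upwards [IsUnifLocDoublingMeasure.ae_tendsto_average (μ := μ) hg 1] with x hx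
  have h1 := hx (l := 𝓝[>] (0 : ℝ)) (fun _ => x) id tendsto_id
    (eventually_mem_nhdsWithin.mono fun σ hσ => mem_closedBall_self (by simpa using le_of_lt hσ))
  refine le_of_tendsto ((ENNReal.continuous_ofReal.tendsto _).comp h1) ?_
  filter_upwards [eventually_mem_nhdsWithin] with σ hσ
  have hσ : 0 < σ := hσ
  have hae : (closedBall x σ : Set E) =ᵐ[μ] ball x σ := by
    refine (ae_eq_of_subset_of_measure_ge ball_subset_closedBall
      (Measure.addHaar_closedBall_eq_addHaar_ball μ x σ).le
      measurableSet_ball.nullMeasurableSet measure_closedBall_lt_top.ne).symm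
  have hint : IntegrableOn g (ball x σ) μ :=
    (hg.integrableOn_isCompact (isCompact_closedBall x σ)).mono_set ball_subset_closedBall
  refine le_trans (le_of_eq ?_) (setLAverage_le_maximalFunction (mem_ball_self hσ))
  simp only [Function.comp, id]
  rw [setAverage_congr hae, ofReal_setAverage hint (Eventually.of_forall hg0), setLAverage_eq]

end MaximalFunction

/-! ### Schur's test -/

/-- Schur's test for the exponent `r`, with test function `φ`: the second condition concerns any
majorant `W` of the outer weight `u` times the `(r - 1)`-th power of the bound in the first. -/
theorem lintegral_mul_rpow_le_of_schur {X : Type*} [MeasurableSpace X] {μ : Measure X} [SFinite μ]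
    {K : X → X → ℝ≥0∞} (hK : Measurable (Function.uncurry K)) {r q : ℝ} (hrq : r.HolderConjugate q)
    {φ Ψ u W : X → ℝ≥0∞} (hφ : Measurable φ) (hW : Measurable W) (hφ0 : ∀ x, φ x ≠ 0)
    (hφt : ∀ᵐ x ∂μ, φ x ≠ ∞) {C : ℝ≥0∞}
    (h1 : ∀ x, ∫⁻ y, K x y * φ y ^ q ∂μ ≤ Ψ x)
    (huW : ∀ᵐ x ∂μ, u x * Ψ x ^ (r - 1) ≤ W x)
    (h2 : ∀ y, ∫⁻ x, K x y * W x ∂μ ≤ C * φ y ^ r)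
    {f : X → ℝ≥0∞} (hf : Measurable f) :
    ∫⁻ x, u x * (∫⁻ y, K x y * f y ∂μ) ^ r ∂μ ≤ C * ∫⁻ y, f y ^ r ∂μ := by
  have hr0 : 0 < r := hrq.pos
  set F : X → ℝ≥0∞ := fun y => (φ y)⁻¹ * f y with hF
  have hFm : Measurable F := hφ.inv.mul hf
  have hKx : ∀ x, Measurable (K x) := fun x => hK.comp measurable_prodMk_left
  have hwd : ∀ x (g : X → ℝ≥0∞), Measurable g →
      ∫⁻ y, K x y * g y ∂μ = ∫⁻ y, g y ∂(μ.withDensity (K x)) := fun x g hg => by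
    rw [lintegral_withDensity_eq_lintegral_mul _ (hKx x) hg]
    rfl
  have hfF : f =ᵐ[μ] fun y => φ y * F y := by
    filter_upwards [hφt] with y hy
    rw [hF, ← mul_assoc, ENNReal.mul_inv_cancel (hφ0 y) hy, one_mul]
  have hpt : ∀ x, (∫⁻ y, K x y * f y ∂μ) ^ r ≤ Ψ x ^ (r - 1) * ∫⁻ y, K x y * F y ^ r ∂μ := by
    intro x
    have e1 : ∫⁻ y, K x y * f y ∂μ = ∫⁻ y, (φ * F) y ∂(μ.withDensity (K x)) := by
      rw [← hwd x _ (hφ.mul hFm)]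
      exact lintegral_congr_ae (hfF.mono fun y hy => by simp only [hy, Pi.mul_apply])
    rw [e1]
    calc _ ≤ ((∫⁻ y, φ y ^ q ∂(μ.withDensity (K x))) ^ (1 / q) *
          (∫⁻ y, F y ^ r ∂(μ.withDensity (K x))) ^ (1 / r)) ^ r := by
          refine ENNReal.rpow_le_rpow ?_ hr0.le
          exact ENNReal.lintegral_mul_le_Lp_mul_Lq _ hrq.symm hφ.aemeasurable hFm.aemeasurable
      _ = (∫⁻ y, K x y * φ y ^ q ∂μ) ^ (r - 1) * ∫⁻ y, K x y * F y ^ r ∂μ := by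
          rw [ENNReal.mul_rpow_of_nonneg _ _ hr0.le, ← ENNReal.rpow_mul, ← ENNReal.rpow_mul,
            one_div_mul_cancel hr0.ne', ENNReal.rpow_one, hwd x _ (hφ.pow_const q),
            hwd x _ (hFm.pow_const r)]
          congr 2
          rw [one_div_mul_eq_div, hrq.div_conj_eq_sub_one]
      _ ≤ _ := by
          gcongr
          · exact hrq.sub_one_pos.le
          · exact h1 x
  have hG : Measurable fun z : X × X => W z.1 * (K z.1 z.2 * F z.2 ^ r) :=
    (hW.comp measurable_fst).mul (hK.mul ((hFm.pow_const r).comp measurable_snd))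
  calc ∫⁻ x, u x * (∫⁻ y, K x y * f y ∂μ) ^ r ∂μ
      ≤ ∫⁻ x, W x * ∫⁻ y, K x y * F y ^ r ∂μ ∂μ := by
        refine lintegral_mono_ae ?_
        filter_upwards [huW] with x hx
        calc _ ≤ u x * (Ψ x ^ (r - 1) * ∫⁻ y, K x y * F y ^ r ∂μ) := by gcongr; exact hpt x
          _ = (u x * Ψ x ^ (r - 1)) * ∫⁻ y, K x y * F y ^ r ∂μ := by ring
          _ ≤ _ := by gcongr
    _ = ∫⁻ x, ∫⁻ y, W x * (K x y * F y ^ r) ∂μ ∂μ := by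
        refine lintegral_congr fun x => ?_
        exact (lintegral_const_mul _ ((hKx x).mul (hFm.pow_const r))).symm
    _ = ∫⁻ y, ∫⁻ x, W x * (K x y * F y ^ r) ∂μ ∂μ := lintegral_lintegral_swap hG.aemeasurable
    _ = ∫⁻ y, (∫⁻ x, K x y * W x ∂μ) * F y ^ r ∂μ := by
        refine lintegral_congr fun y => ?_
        refine Eq.trans (lintegral_congr fun x => ?_)
          (lintegral_mul_const _ ((hK.comp measurable_prodMk_right).mul hW))
        ring
    _ ≤ ∫⁻ y, C * f y ^ r ∂μ := by
        refine lintegral_mono_ae ?_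
        filter_upwards [hfF] with y hy
        calc _ ≤ C * φ y ^ r * F y ^ r := by gcongr; exact h2 y
          _ = C * (φ y * F y) ^ r := by
            rw [ENNReal.mul_rpow_of_nonneg (φ y) (F y) hr0.le, mul_assoc]
          _ = C * f y ^ r := by rw [← hy]
    _ = _ := lintegral_const_mul _ (hf.pow_const r)

/-! ### Potentials of powers of the maximal function -/

theorem lintegral_Ioc_rpow {K a ε : ℝ} (hK : 0 ≤ K) (ha : 0 < a) (hε : 0 ≤ ε) :
    ∫⁻ ρ in Ioc 0 ε, ENNReal.ofReal (K * ρ ^ (a - 1)) = ENNReal.ofReal (K * (ε ^ a / a)) := by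
  rw [← ofReal_integral_eq_lintegral_ofReal, integral_const_mul,
    ← intervalIntegral.integral_of_le hε, integral_rpow (Or.inl (by linarith))]
  · simp [Real.zero_rpow ha.ne']
  · refine Integrable.const_mul ?_ K
    exact (intervalIntegrable_iff_integrableOn_Ioc_of_le hε).1
      (intervalIntegral.intervalIntegrable_rpow' (by linarith))
  · filter_upwards [ae_restrict_mem measurableSet_Ioc] with ρ hρ
    exact mul_nonneg hK (Real.rpow_nonneg hρ.1.le _)

theorem lintegral_Ioi_rpow {K a ε : ℝ} (hK : 0 ≤ K) (ha : 0 < a) (hε : 0 < ε) :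
    ∫⁻ ρ in Ioi ε, ENNReal.ofReal (K * ρ ^ (-a - 1)) = ENNReal.ofReal (K * (ε ^ (-a) / a)) := by
  rw [← ofReal_integral_eq_lintegral_ofReal, integral_const_mul,
    integral_Ioi_rpow_of_lt (by linarith) hε]
  · simp [neg_div_neg_eq]
  · exact (integrableOn_Ioi_rpow_of_lt (by linarith) hε).const_mul K
  · filter_upwards [ae_restrict_mem measurableSet_Ioi] with ρ hρ
    exact mul_nonneg hK (Real.rpow_nonneg (hε.trans hρ).le _)

section Potential

variable {E : Type*} [NormedAddCommGroup E]

/-- The Riesz kernel `|x - y| ^ (-β)` with values in `[0, ∞]`; it is `0` for `x = y` and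
`β ≠ 0`. -/
noncomputable def rieszKernel (β : ℝ) (x y : E) : ℝ≥0∞ :=
  ENNReal.ofReal (‖x - y‖ ^ (-β))

theorem rieszKernel_comm (β : ℝ) (x y : E) : rieszKernel β x y = rieszKernel β y x := by
  rw [rieszKernel, rieszKernel, norm_sub_rev]

variable [MeasurableSpace E] [BorelSpace E] [NormedSpace ℝ E] [FiniteDimensional ℝ E]

theorem measurable_rieszKernel (β : ℝ) :
    Measurable (Function.uncurry (rieszKernel (E := E) β)) := by
  unfold rieszKernel Function.uncurry
  have : Measurable fun a : E × E => ‖a.1 - a.2‖ :=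
    (continuous_fst.sub continuous_snd).norm.measurable
  fun_prop

variable (μ : Measure E) [μ.IsAddHaarMeasure]

/-- The potential as a superposition of integrals over balls. -/
theorem lintegral_rieszKernel_mul_le {β : ℝ} (hβ : 0 < β) {V : E → ℝ≥0∞} (hV : Measurable V)
    (x : E) :
    ∫⁻ y, rieszKernel β x y * V y ∂μ ≤
      ∫⁻ ρ in Ioi (0 : ℝ), ENNReal.ofReal (β * ρ ^ (-β - 1)) * ∫⁻ y in ball x ρ, V y ∂μ := by
  set S : Set (E × ℝ) := {q | dist q.1 x < q.2} with hS
  have hSm : MeasurableSet S := measurableSet_lt (by fun_prop) measurable_snd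
  have hker : ∀ y, rieszKernel β x y ≤
      ∫⁻ ρ in Ioi (0 : ℝ), S.indicator (fun q => ENNReal.ofReal (β * q.2 ^ (-β - 1))) (y, ρ) := by
    intro y
    rcases eq_or_ne x y with rfl | hxy
    · simp [rieszKernel, Real.zero_rpow (neg_ne_zero.2 hβ.ne')]
    · have hd : 0 < dist y x := dist_pos.2 hxy.symm
      have := lintegral_Ioi_rpow hβ.le hβ hd
      rw [mul_div_cancel₀ _ hβ.ne', dist_comm, dist_eq_norm] at this
      rw [rieszKernel, ← this, ← dist_eq_norm, dist_comm,
        ← lintegral_indicator measurableSet_Ioi, ← lintegral_indicator measurableSet_Ioi]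
      refine lintegral_mono fun ρ => ?_
      by_cases hρ : dist y x < ρ
      · rw [indicator_of_mem (by exact hρ), indicator_of_mem (by exact hd.trans hρ),
          indicator_of_mem (by exact hρ)]
      · rw [indicator_of_notMem (by exact hρ)]
        exact zero_le
  have hm : Measurable fun q : E × ℝ =>
      S.indicator (fun q => ENNReal.ofReal (β * q.2 ^ (-β - 1))) q :=
    Measurable.indicator (by fun_prop) hSm
  calc ∫⁻ y, rieszKernel β x y * V y ∂μ
      ≤ ∫⁻ y, (∫⁻ ρ in Ioi (0 : ℝ),
          S.indicator (fun q => ENNReal.ofReal (β * q.2 ^ (-β - 1))) (y, ρ)) * V y ∂μ := by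
        gcongr with y
        exact hker y
    _ = ∫⁻ y, (∫⁻ ρ in Ioi (0 : ℝ),
          S.indicator (fun q => ENNReal.ofReal (β * q.2 ^ (-β - 1))) (y, ρ) * V y) ∂μ := by
        refine lintegral_congr fun y => ?_
        exact (lintegral_mul_const _ (hm.comp measurable_prodMk_left)).symm
    _ = ∫⁻ ρ in Ioi (0 : ℝ), ∫⁻ y,
          S.indicator (fun q => ENNReal.ofReal (β * q.2 ^ (-β - 1))) (y, ρ) * V y ∂μ :=
        lintegral_lintegral_swap (hm.mul (hV.comp measurable_fst)).aemeasurable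
    _ = _ := by
        refine lintegral_congr fun ρ => ?_
        rw [← lintegral_const_mul _ hV, ← lintegral_indicator measurableSet_ball]
        refine lintegral_congr fun y => ?_
        by_cases hρ : dist y x < ρ
        · rw [indicator_of_mem (by exact hρ), indicator_of_mem (by exact hρ)]
        · rw [indicator_of_notMem (by exact hρ), indicator_of_notMem (by exact hρ), zero_mul]

variable [Nontrivial E]

/-- If the averages of `g` over the balls of radius `σ` about `x` are at most `(A * σ ^ (-α)) ^ p`,
then the potential of `(M g) ^ δ` is bounded pointwise by a power of `M g`: the `A₁` property
controls the small radii and the Morrey bound the large ones. -/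
theorem exists_potential_maximalFunction_rpow_le {α p δ : ℝ} (hα : 0 < α)
    (hαd : α < Module.finrank ℝ E) (hp : 0 < p) (hδp : 1 / p < δ) (hδ1 : δ < 1) :
    ∃ C : ℝ, 0 < C ∧ ∀ (g : E → ℝ≥0∞) (x : E) (A : ℝ), 0 < A →
      (∀ σ, 0 < σ → ∫⁻ y in ball x σ, g y ∂μ ≤
        ENNReal.ofReal ((A * σ ^ (-α)) ^ p) * μ (ball x σ)) →
      maximalFunction μ g x ≠ 0 →
      ∫⁻ y, rieszKernel (Module.finrank ℝ E - α) x y * maximalFunction μ g y ^ δ ∂μ ≤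
        ENNReal.ofReal (C * A) * maximalFunction μ g x ^ (δ - 1 / p) := by
  set D := Module.finrank ℝ E with hD
  have hδ0 : 0 < δ := (one_div_pos.2 hp).trans hδp
  have hpδ : 1 < p * δ := by rwa [div_lt_iff₀' hp] at hδp
  obtain ⟨C₁, hC₁, H⟩ := exists_setLIntegral_maximalFunction_rpow_le μ hδ0 hδ1
  set c : ℝ := (C₁ * μ (ball (0 : E) 1)).toReal + 1 with hc
  have hc0 : 0 < c := by positivity
  have hcle : C₁ * μ (ball (0 : E) 1) ≤ ENNReal.ofReal c := by
    rw [← ENNReal.ofReal_toReal (ENNReal.mul_ne_top hC₁ measure_ball_lt_top.ne)]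
    exact ENNReal.ofReal_le_ofReal (by linarith)
  set β : ℝ := D - α with hβ
  have hβ0 : 0 < β := sub_pos.2 hαd
  set γ : ℝ := α * (p * δ - 1) with hγ
  have hγ0 : 0 < γ := mul_pos hα (by linarith)
  refine ⟨β * c * (1 / α + 1 / γ), by positivity, ?_⟩
  intro g x A hA hg hw0
  rcases eq_or_ne (maximalFunction μ g x) ∞ with hwt | hwt
  · rw [hwt, ENNReal.top_rpow_of_pos (by linarith), ENNReal.mul_top]
    · exact le_top
    · exact (ENNReal.ofReal_pos.2 (by positivity)).ne'
  obtain ⟨w, hw, hwx⟩ : ∃ w : ℝ, 0 < w ∧ maximalFunction μ g x = ENNReal.ofReal w :=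
    ⟨_, ENNReal.toReal_pos hw0 hwt, (ENNReal.ofReal_toReal hwt).symm⟩
  have hball : ∀ ρ m : ℝ, 0 < ρ → 0 < m →
      (∀ σ, ρ ≤ σ → ∫⁻ y in ball x σ, g y ∂μ ≤ ENNReal.ofReal m * μ (ball x σ)) →
      ∫⁻ y in ball x ρ, maximalFunction μ g y ^ δ ∂μ ≤ ENNReal.ofReal (c * m ^ δ * ρ ^ D) := by
    intro ρ m hρ hm h
    refine (H g x ρ _ hρ (ENNReal.ofReal_pos.2 hm).ne' ENNReal.ofReal_ne_top h).trans ?_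
    rw [Measure.addHaar_ball_of_pos μ x hρ, ENNReal.ofReal_rpow_of_pos hm,
      ENNReal.ofReal_mul (by positivity), ENNReal.ofReal_mul hc0.le]
    calc _ = C₁ * μ (ball (0 : E) 1) * ENNReal.ofReal (m ^ δ) * ENNReal.ofReal (ρ ^ D) := by ring
      _ ≤ _ := by gcongr
  have hsmall : ∀ ρ, 0 < ρ →
      ∫⁻ y in ball x ρ, maximalFunction μ g y ^ δ ∂μ ≤ ENNReal.ofReal (c * w ^ δ * ρ ^ D) := by
    intro ρ hρ
    refine hball ρ w hρ hw fun σ hσ => ?_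
    rw [← hwx]
    exact setLIntegral_ball_le_maximalFunction μ g x (hρ.trans_le hσ)
  have hlarge : ∀ ρ, 0 < ρ → ∫⁻ y in ball x ρ, maximalFunction μ g y ^ δ ∂μ ≤
      ENNReal.ofReal (c * ((A * ρ ^ (-α)) ^ p) ^ δ * ρ ^ D) := by
    intro ρ hρ
    refine hball ρ _ hρ (by positivity) fun σ hσ => (hg σ (hρ.trans_le hσ)).trans ?_
    have : σ ^ (-α) ≤ ρ ^ (-α) := Real.rpow_le_rpow_of_nonpos hρ hσ (by linarith)
    have h0 : 0 ≤ σ ^ (-α) := Real.rpow_nonneg (hρ.le.trans hσ) _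
    gcongr
  -- The two bounds agree at the radius `ε`, where `ε ^ α = A * w ^ (-1 / p)`.
  set e : ℝ := A * w ^ (-(1 / p)) with he
  have he0 : 0 < e := by positivity
  set ε : ℝ := e ^ (1 / α) with hε
  have hε0 : 0 < ε := by positivity
  have hεα : ε ^ α = e := by
    rw [hε, ← Real.rpow_mul he0.le, one_div_mul_cancel hα.ne', Real.rpow_one]
  have hεγ : A ^ (p * δ) * ε ^ (-γ) = w ^ δ * e := by
    have h1 : ε ^ (-γ) = e ^ (1 - p * δ) := by
      rw [← hεα, ← Real.rpow_mul hε0.le, hγ]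
      ring_nf
    rw [h1, he, Real.mul_rpow hA.le (by positivity), ← Real.rpow_mul hw.le]
    have h2 : -(1 / p) * (1 - p * δ) = δ - 1 / p := by field_simp; ring
    rw [h2, Real.rpow_sub hA, Real.rpow_one, Real.rpow_sub hw, Real.rpow_neg hw.le]
    field_simp
  calc ∫⁻ y, rieszKernel β x y * maximalFunction μ g y ^ δ ∂μ
      ≤ ∫⁻ ρ in Ioi (0 : ℝ), ENNReal.ofReal (β * ρ ^ (-β - 1)) *
          ∫⁻ y in ball x ρ, maximalFunction μ g y ^ δ ∂μ :=
        lintegral_rieszKernel_mul_le μ hβ0 ((measurable_maximalFunction μ g).pow_const δ) x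
    _ ≤ (∫⁻ ρ in Ioc 0 ε, ENNReal.ofReal (β * ρ ^ (-β - 1)) *
          ∫⁻ y in ball x ρ, maximalFunction μ g y ^ δ ∂μ) +
        ∫⁻ ρ in Ioi ε, ENNReal.ofReal (β * ρ ^ (-β - 1)) *
          ∫⁻ y in ball x ρ, maximalFunction μ g y ^ δ ∂μ := by
        rw [← Ioc_union_Ioi_eq_Ioi hε0.le]
        exact lintegral_union_le _ _ _
    _ ≤ (∫⁻ ρ in Ioc 0 ε, ENNReal.ofReal (β * c * w ^ δ * ρ ^ (α - 1))) +
        ∫⁻ ρ in Ioi ε, ENNReal.ofReal (β * c * A ^ (p * δ) * ρ ^ (-γ - 1)) := by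
        refine add_le_add (setLIntegral_mono' measurableSet_Ioc fun ρ hρ => ?_)
          (setLIntegral_mono' measurableSet_Ioi fun ρ hρ => ?_)
        · have hρ0 : 0 < ρ := hρ.1
          refine (mul_le_mul_right (hsmall ρ hρ0) _).trans (le_of_eq ?_)
          rw [← ENNReal.ofReal_mul (by positivity)]
          congr 1
          have : ρ ^ (α - 1) = ρ ^ (-β - 1) * ρ ^ D := by
            rw [← Real.rpow_natCast, ← Real.rpow_add hρ0, hβ]
            ring_nf
          rw [this]
          ring
        · have hρ0 : 0 < ρ := hε0.trans hρ
          refine (mul_le_mul_right (hlarge ρ hρ0) _).trans (le_of_eq ?_)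
          rw [← ENNReal.ofReal_mul (by positivity)]
          congr 1
          have h1 : ((A * ρ ^ (-α)) ^ p) ^ δ = A ^ (p * δ) * ρ ^ (-α * (p * δ)) := by
            rw [← Real.rpow_mul (by positivity), Real.mul_rpow hA.le (by positivity),
              ← Real.rpow_mul hρ0.le]
          have h2 : ρ ^ (-γ - 1) = ρ ^ (-β - 1) * ρ ^ (-α * (p * δ)) * ρ ^ D := by
            rw [← Real.rpow_natCast, ← Real.rpow_add hρ0, ← Real.rpow_add hρ0, hβ, hγ]
            ring_nf
          rw [h1, h2]
          ring
    _ = ENNReal.ofReal (β * c * (1 / α + 1 / γ) * A * w ^ (δ - 1 / p)) := by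
        rw [lintegral_Ioc_rpow (by positivity) hα hε0.le,
          lintegral_Ioi_rpow (by positivity) hγ0 hε0,
          ← ENNReal.ofReal_add (by positivity) (by positivity), hεα]
        congr 1
        have h1 : A * w ^ (δ - 1 / p) = w ^ δ * e := by
          rw [he, sub_eq_add_neg, Real.rpow_add hw]
          ring
        calc _ = β * c * (w ^ δ * e) / α + β * c * (A ^ (p * δ) * ε ^ (-γ)) / γ := by ring
          _ = β * c * (1 / α + 1 / γ) * (A * w ^ (δ - 1 / p)) := by rw [hεγ, h1]; ring
          _ = _ := by ring
    _ = _ := by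
        rw [hwx, ENNReal.ofReal_rpow_of_pos hw, ← ENNReal.ofReal_mul (by positivity)]

end Potential

/-! ### The weighted inequality in terms of the lower Lebesgue integral -/

section WeightedInequality

variable {E : Type*} [NormedAddCommGroup E] [MeasurableSpace E]

theorem ae_eq_zero_of_setLIntegral_ball_eq_zero {μ : Measure E} {g : E → ℝ≥0∞}
    (hg : AEMeasurable g μ) {x : E} (h : ∀ σ, 0 < σ → ∫⁻ y in ball x σ, g y ∂μ = 0) :
    g =ᵐ[μ] 0 := by
  rw [← Measure.restrict_univ (μ := μ), ← iUnion_ball_nat_succ x]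
  refine (ae_restrict_iUnion_iff _ _).2 fun n => ?_
  exact (lintegral_eq_zero_iff' hg.restrict).1 (h _ (by positivity))

variable [BorelSpace E] [NormedSpace ℝ E] [FiniteDimensional ℝ E] [Nontrivial E]
  (μ : Measure E) [μ.IsAddHaarMeasure]

theorem ae_maximalFunction_ne_top {α p A : ℝ} (hα : 0 < α) (hp : 0 < p) (hA : 0 < A)
    {g : E → ℝ≥0∞} {x : E}
    (hg : ∀ σ, 0 < σ → ∫⁻ y in ball x σ, g y ∂μ ≤
        ENNReal.ofReal ((A * σ ^ (-α)) ^ p) * μ (ball x σ)) :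
    ∀ᵐ y ∂μ, maximalFunction μ g y ≠ ∞ := by
  obtain ⟨C, hC, H⟩ := exists_setLIntegral_maximalFunction_rpow_le μ
    (show (0 : ℝ) < 1 / 2 by norm_num) (by norm_num)
  suffices h : ∀ᵐ y ∂μ.restrict univ, maximalFunction μ g y ≠ ∞ by
    rwa [Measure.restrict_univ] at h
  rw [← iUnion_ball_nat_succ x]
  refine (ae_restrict_iUnion_iff _ _).2 fun n => ?_
  set ρ : ℝ := (n : ℝ) + 1 with hρ
  have hρ0 : 0 < ρ := by positivity
  have hm : 0 < (A * ρ ^ (-α)) ^ p := by positivity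
  have key := H g x ρ (ENNReal.ofReal ((A * ρ ^ (-α)) ^ p)) hρ0 (ENNReal.ofReal_pos.2 hm).ne'
    ENNReal.ofReal_ne_top fun σ hσ => by
      refine (hg σ (hρ0.trans_le hσ)).trans ?_
      have : σ ^ (-α) ≤ ρ ^ (-α) := Real.rpow_le_rpow_of_nonpos hρ0 hσ (by linarith)
      have h0 : 0 ≤ σ ^ (-α) := Real.rpow_nonneg (hρ0.le.trans hσ) _
      gcongr
  have hfin : ∫⁻ y in ball x ρ, maximalFunction μ g y ^ (1 / 2 : ℝ) ∂μ ≠ ∞ :=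
    ne_top_of_le_ne_top (ENNReal.mul_ne_top (ENNReal.mul_ne_top hC (by simp))
      measure_ball_lt_top.ne) key
  filter_upwards [ae_lt_top ((measurable_maximalFunction μ g).pow_const _) hfin] with y hy hyt
  rw [hyt] at hy
  simp at hy

/-- The weighted inequality for potentials of nonnegative functions. Schur's test is applied with
powers of `w = M (b ^ p)`, where `b ≤ w ^ (1 / p)` almost everywhere. -/
theorem exists_lintegral_mul_potential_rpow_le {α r p : ℝ} (hα : 0 < α)
    (hαd : α < Module.finrank ℝ E) (hr : 1 < r) (hrp : r < p) :
    ∃ C : ℝ, 0 < C ∧ ∀ (A : ℝ) (b : E → ℝ), 0 ≤ A → (∀ x, 0 ≤ b x) →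
      LocallyIntegrable (fun x => b x ^ p) μ →
      (∀ x σ, 0 < σ → ∫⁻ y in ball x σ, ENNReal.ofReal (b y ^ p) ∂μ ≤
        ENNReal.ofReal ((A * σ ^ (-α)) ^ p) * μ (ball x σ)) →
      ∀ f : E → ℝ≥0∞, Measurable f →
      ∫⁻ x, ENNReal.ofReal (b x) ^ r *
          (∫⁻ y, rieszKernel (Module.finrank ℝ E - α) x y * f y ∂μ) ^ r ∂μ ≤
        ENNReal.ofReal (C * A ^ r) * ∫⁻ y, f y ^ r ∂μ := by
  have hr0 : 0 < r := by linarith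
  have hr1 : 0 < r - 1 := by linarith
  have hp0 : 0 < p := by linarith
  -- The powers `t / p` and `τ / p` of `w`, where `τ = (t - 1) / (r - 1)`, both lie in `(1 / p, 1)`.
  obtain ⟨t, hrt, ht⟩ : ∃ t, r < t ∧ t < min p (1 + p * (r - 1)) := by
    refine exists_between (lt_min hrp ?_)
    nlinarith
  obtain ⟨htp, htτ⟩ := lt_min_iff.1 ht
  set δ₁ : ℝ := (t - 1) / (r - 1) / p with hδ₁
  set δ₂ : ℝ := t / p with hδ₂
  have hδ₁p : 1 / p < δ₁ := by
    rw [hδ₁]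
    gcongr
    rw [one_lt_div hr1]
    linarith
  have hδ₁1 : δ₁ < 1 := by
    rw [hδ₁, div_lt_one hp0, div_lt_iff₀ hr1]
    linarith
  have hδ₂p : 1 / p < δ₂ := by
    rw [hδ₂]
    gcongr
    linarith
  have hδ₂1 : δ₂ < 1 := (div_lt_one hp0).2 htp
  obtain ⟨C₁, hC₁, H₁⟩ := exists_potential_maximalFunction_rpow_le μ hα hαd hp0 hδ₁p hδ₁1
  obtain ⟨C₂, hC₂, H₂⟩ := exists_potential_maximalFunction_rpow_le μ hα hαd hp0 hδ₂p hδ₂1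
  refine ⟨C₁ ^ (r - 1) * C₂, by positivity, ?_⟩
  intro A b hA hb hbloc hM f hf
  set g : E → ℝ≥0∞ := fun x => ENNReal.ofReal (b x ^ p) with hg
  have hgm : AEMeasurable g μ := hbloc.aestronglyMeasurable.aemeasurable.ennreal_ofReal
  -- Schur's test needs `w ≠ 0`, which holds everywhere unless `b` vanishes almost everywhere.
  by_cases hg0 : g =ᵐ[μ] 0
  · refine le_trans (le_of_eq ?_) zero_le
    rw [lintegral_eq_zero_of_ae_eq_zero]
    filter_upwards [hg0] with x hx
    have h1 : b x ^ p ≤ 0 := ENNReal.ofReal_eq_zero.1 hx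
    have h2 : b x = 0 := by
      by_contra hne
      exact h1.not_gt (Real.rpow_pos_of_pos ((hb x).lt_of_ne' hne) p)
    simp [h2, hr0]
  have hA0 : 0 < A := by
    refine hA.lt_of_ne' fun h => hg0 ?_
    refine ae_eq_zero_of_setLIntegral_ball_eq_zero hgm (x := 0) fun σ hσ => ?_
    have := hM 0 σ hσ
    rw [h, zero_mul, Real.zero_rpow hp0.ne', ENNReal.ofReal_zero, zero_mul] at this
    exact le_antisymm this zero_le
  set w : E → ℝ≥0∞ := maximalFunction μ g with hw
  have hwm : Measurable w := measurable_maximalFunction μ g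
  have hw0 : ∀ x, w x ≠ 0 := fun x h => hg0 <|
    ae_eq_zero_of_setLIntegral_ball_eq_zero hgm (x := x) fun σ hσ => by
      have := setLIntegral_ball_le_maximalFunction μ g x hσ
      rw [← hw, h, zero_mul] at this
      exact le_antisymm this zero_le
  have hwt : ∀ᵐ x ∂μ, w x ≠ ∞ := ae_maximalFunction_ne_top μ hα hp0 hA0 (hM 0)
  have hbw : ∀ᵐ x ∂μ, ENNReal.ofReal (b x) ^ r ≤ w x ^ (r / p) := by
    filter_upwards [ae_ofReal_le_maximalFunction μ hbloc fun x => Real.rpow_nonneg (hb x) p]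
      with x hx
    rw [← ENNReal.ofReal_rpow_of_nonneg (hb x) hp0.le] at hx
    calc ENNReal.ofReal (b x) ^ r = (ENNReal.ofReal (b x) ^ p) ^ (r / p) := by
          rw [← ENNReal.rpow_mul, mul_div_cancel₀ _ hp0.ne']
      _ ≤ w x ^ (r / p) := ENNReal.rpow_le_rpow hx (by positivity)
  have hφ_exp : 0 < (t - 1) / (p * r) := div_pos (by linarith) (by positivity)
  have key := lintegral_mul_rpow_le_of_schur (μ := μ)
    (measurable_rieszKernel (E := E) (Module.finrank ℝ E - α))
    (Real.HolderConjugate.conjExponent hr)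
    (φ := fun x => w x ^ ((t - 1) / (p * r)))
    (Ψ := fun x => ENNReal.ofReal (C₁ * A) * w x ^ (δ₁ - 1 / p))
    (u := fun x => ENNReal.ofReal (b x) ^ r)
    (W := fun x => ENNReal.ofReal (C₁ * A) ^ (r - 1) * w x ^ δ₂)
    (C := ENNReal.ofReal (C₁ * A) ^ (r - 1) * ENNReal.ofReal (C₂ * A))
    (hwm.pow_const _) ((hwm.pow_const _).const_mul _)
    (fun x => by simp [hw0 x, hφ_exp.not_gt])
    (hwt.mono fun x hx => ENNReal.rpow_ne_top_of_nonneg hφ_exp.le hx) ?_ ?_ ?_ hf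
  · convert key using 2
    rw [ENNReal.ofReal_rpow_of_pos (by positivity), ← ENNReal.ofReal_mul (by positivity),
      Real.mul_rpow hC₁.le hA, Real.rpow_sub_one hA0.ne']
    congr 1
    field_simp
  · intro x
    refine le_trans (le_of_eq ?_) (H₁ g x A hA0 (hM x) (hw0 x))
    refine lintegral_congr fun y => ?_
    rw [← ENNReal.rpow_mul]
    congr 2
    rw [hδ₁, Real.conjExponent]
    field_simp
  · filter_upwards [hbw] with x hx
    rw [ENNReal.mul_rpow_of_nonneg _ _ hr1.le, ← ENNReal.rpow_mul]
    calc _ ≤ w x ^ (r / p) * (ENNReal.ofReal (C₁ * A) ^ (r - 1) *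
          w x ^ ((δ₁ - 1 / p) * (r - 1))) := by gcongr
      _ = ENNReal.ofReal (C₁ * A) ^ (r - 1) *
          (w x ^ (r / p) * w x ^ ((δ₁ - 1 / p) * (r - 1))) := by ring
      _ = _ := by
        rw [← ENNReal.rpow_add_of_nonneg _ _ (by positivity)
          (mul_nonneg (by linarith) hr1.le)]
        congr 2
        rw [hδ₁, hδ₂]
        field_simp
        ring
  · intro y
    calc ∫⁻ x, rieszKernel (Module.finrank ℝ E - α) x y *
          (ENNReal.ofReal (C₁ * A) ^ (r - 1) * w x ^ δ₂) ∂μ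
        = ∫⁻ x, ENNReal.ofReal (C₁ * A) ^ (r - 1) *
          (rieszKernel (Module.finrank ℝ E - α) y x * w x ^ δ₂) ∂μ := by
          refine lintegral_congr fun x => ?_
          rw [rieszKernel_comm]
          ring
      _ = ENNReal.ofReal (C₁ * A) ^ (r - 1) *
          ∫⁻ x, rieszKernel (Module.finrank ℝ E - α) y x * w x ^ δ₂ ∂μ :=
          lintegral_const_mul _
            (((measurable_rieszKernel _).comp measurable_prodMk_left).mul (hwm.pow_const _))
      _ ≤ ENNReal.ofReal (C₁ * A) ^ (r - 1) *
          (ENNReal.ofReal (C₂ * A) * w y ^ (δ₂ - 1 / p)) := by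
          gcongr
          exact H₂ g y A hA0 (hM y) (hw0 y)
      _ = _ := by
          rw [← ENNReal.rpow_mul, mul_assoc]
          congr 3
          rw [hδ₂]
          field_simp

end WeightedInequality

/-! ### The Riesz potential on Euclidean space -/

theorem MorreyBound.nonneg {d : ℕ} {p α A : ℝ} {b : EuclideanSpace ℝ (Fin d) → ℝ}
    (h : MorreyBound p α A b) (hb : ∀ x, 0 ≤ b x) : 0 ≤ A := by
  have h1 := (h 0 1 one_pos).2
  rw [Real.one_rpow, mul_one] at h1
  refine le_trans (Real.rpow_nonneg ?_ _) h1
  rw [setAverage_eq]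
  exact smul_nonneg (by positivity) (integral_nonneg fun x => Real.rpow_nonneg (hb x) p)

theorem MorreyBound.locallyIntegrable {d : ℕ} {p α A : ℝ} {b : EuclideanSpace ℝ (Fin d) → ℝ}
    (h : MorreyBound p α A b) : LocallyIntegrable (fun x => b x ^ p) volume := fun x =>
  ⟨ball x 1, ball_mem_nhds x one_pos, (h x 1 one_pos).1⟩

theorem MorreyBound.setLIntegral_le {d : ℕ} {p α A : ℝ} (hp : 0 < p)
    {b : EuclideanSpace ℝ (Fin d) → ℝ} (h : MorreyBound p α A b) (hb : ∀ x, 0 ≤ b x)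
    (x : EuclideanSpace ℝ (Fin d)) {σ : ℝ} (hσ : 0 < σ) :
    ∫⁻ y in ball x σ, ENNReal.ofReal (b y ^ p) ≤
      ENNReal.ofReal ((A * σ ^ (-α)) ^ p) * volume (ball x σ) := by
  obtain ⟨hint, hle⟩ := h x σ hσ
  have hb' : ∀ y, 0 ≤ b y ^ p := fun y => Real.rpow_nonneg (hb y) p
  have havg : 0 ≤ ⨍ y in ball x σ, b y ^ p := by
    rw [setAverage_eq]
    exact smul_nonneg (by positivity) (integral_nonneg hb')
  have h1 := Real.rpow_le_rpow (Real.rpow_nonneg havg _) hle hp.le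
  rw [← Real.rpow_mul havg, one_div_mul_cancel hp.ne', Real.rpow_one] at h1
  have h2 := ENNReal.ofReal_le_ofReal h1
  rwa [ofReal_setAverage hint (Eventually.of_forall hb'),
    ENNReal.div_le_iff (measure_ball_pos _ x hσ).ne' measure_ball_lt_top.ne] at h2

theorem lintegral_enorm_rieszIntegrand {d : ℕ} (α : ℝ) (f : EuclideanSpace ℝ (Fin d) → ℝ)
    (x : EuclideanSpace ℝ (Fin d)) :
    ∫⁻ y, ‖rieszIntegrand α f x y‖ₑ = ∫⁻ y, rieszKernel (d - α) x y * ‖f y‖ₑ := by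
  rw [← lintegral_add_left_eq_self (fun y => rieszKernel (d - α) x y * ‖f y‖ₑ) x]
  refine lintegral_congr fun y => ?_
  rw [rieszIntegrand, rieszKernel, div_eq_mul_inv, enorm_mul, mul_comm,
    ← Real.rpow_neg (norm_nonneg y), Real.enorm_of_nonneg (Real.rpow_nonneg (norm_nonneg y) _)]
  simp

theorem rieszIntegrand_ae_congr {d : ℕ} (α : ℝ) {f f' : EuclideanSpace ℝ (Fin d) → ℝ}
    (h : f =ᵐ[volume] f') (x : EuclideanSpace ℝ (Fin d)) :
    rieszIntegrand α f x =ᵐ[volume] rieszIntegrand α f' x := by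
  filter_upwards [(quasiMeasurePreserving_add_left volume x).ae h] with y hy
  rw [rieszIntegrand, rieszIntegrand, hy]

theorem measurable_uncurry_rieszIntegrand {d : ℕ} (α : ℝ) {f : EuclideanSpace ℝ (Fin d) → ℝ}
    (hf : Measurable f) : Measurable (Function.uncurry (rieszIntegrand α f)) := by
  unfold rieszIntegrand Function.uncurry
  fun_prop

theorem theorem1 (d : ℕ) (hd : 1 ≤ d) (α r p : ℝ) (hα : 0 < α) (hαd : α < d)
    (hr : 1 < r) (hrp : r < p) :
    ∃ N : ℝ, 0 < N ∧
      ∀ (A : ℝ) (b : EuclideanSpace ℝ (Fin d) → ℝ), AEMeasurable b volume → (∀ x, 0 ≤ b x) →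
        MorreyBound p α A b →
      ∀ f : EuclideanSpace ℝ (Fin d) → ℝ, MemLp f (ENNReal.ofReal r) volume →
        (∀ᵐ x : EuclideanSpace ℝ (Fin d), b x ≠ 0 →
          Integrable (rieszIntegrand α f x) volume) ∧
        Integrable (fun x => b x ^ r * |rieszPotential α f x| ^ r) volume ∧
        ∫ x, b x ^ r * |rieszPotential α f x| ^ r ≤ N * A ^ r * ∫ x, |f x| ^ r := by
  have : Nonempty (Fin d) := ⟨⟨0, hd⟩⟩
  have hr0 : 0 < r := by linarith
  have hp0 : 0 < p := by linarith
  have hfin : Module.finrank ℝ (EuclideanSpace ℝ (Fin d)) = d := by simp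
  obtain ⟨N, hN, H⟩ := exists_lintegral_mul_potential_rpow_le
    (volume : Measure (EuclideanSpace ℝ (Fin d))) hα (by rwa [hfin]) hr hrp
  refine ⟨N, hN, ?_⟩
  intro A b hbm hb hM f hf
  have hA : 0 ≤ A := hM.nonneg hb
  obtain ⟨f', hf'm, hff'⟩ := hf.1
  have hf'meas : Measurable f' := hf'm.measurable
  set P : EuclideanSpace ℝ (Fin d) → ℝ≥0∞ := fun x => ∫⁻ y, ‖rieszIntegrand α f x y‖ₑ with hP
  have hPf' : ∀ x, P x = ∫⁻ y, ‖rieszIntegrand α f' x y‖ₑ := fun x =>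
    lintegral_congr_ae ((rieszIntegrand_ae_congr α hff' x).mono fun y hy => by simp only [hy])
  have hunc := measurable_uncurry_rieszIntegrand α hf'meas
  have hPm : Measurable P := by
    rw [funext hPf']
    exact hunc.enorm.lintegral_prod_right'
  have hRm : StronglyMeasurable (rieszPotential α f) := by
    have : rieszPotential α f = fun x => ∫ y, rieszIntegrand α f' x y :=
      funext fun x => integral_congr_ae (rieszIntegrand_ae_congr α hff' x)
    rw [this]
    exact hunc.stronglyMeasurable.integral_prod_right'
  have hfr : Integrable (fun x => |f x| ^ r) volume := by
    have := hf.integrable_norm_rpow (by simpa using hr0) ENNReal.ofReal_ne_top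
    simpa only [ENNReal.toReal_ofReal hr0.le, Real.norm_eq_abs] using this
  have hf'r : ∫⁻ y, ‖f' y‖ₑ ^ r = ENNReal.ofReal (∫ x, |f x| ^ r) := by
    rw [ofReal_integral_eq_lintegral_ofReal hfr
      (Eventually.of_forall fun x => Real.rpow_nonneg (abs_nonneg _) r)]
    refine lintegral_congr_ae (hff'.mono fun y hy => ?_)
    simp only
    rw [← hy, ← ENNReal.ofReal_rpow_of_nonneg (abs_nonneg _) hr0.le, Real.enorm_eq_ofReal_abs]
  have hfnn : 0 ≤ ∫ x, |f x| ^ r := integral_nonneg fun x => Real.rpow_nonneg (abs_nonneg _) r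
  have hmain : ∫⁻ x, ENNReal.ofReal (b x) ^ r * P x ^ r ≤
      ENNReal.ofReal (N * A ^ r * ∫ x, |f x| ^ r) := by
    have := H A b hA hb hM.locallyIntegrable (fun x σ hσ => hM.setLIntegral_le hp0 hb x hσ)
      (fun y => ‖f' y‖ₑ) hf'meas.enorm
    rw [hfin, hf'r, ← ENNReal.ofReal_mul (by positivity)] at this
    refine le_trans (le_of_eq (lintegral_congr fun x => ?_)) this
    rw [hPf', lintegral_enorm_rieszIntegrand]
  have hbP : AEMeasurable (fun x => ENNReal.ofReal (b x) ^ r * P x ^ r) volume :=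
    (hbm.ennreal_ofReal.pow_const r).mul (hPm.pow_const r).aemeasurable
  have hmeas : AEStronglyMeasurable (fun x => b x ^ r * |rieszPotential α f x| ^ r) volume :=
    ((hbm.pow_const r).mul
      ((hRm.measurable.norm.pow_const r).aemeasurable)).aestronglyMeasurable
  have hnn : ∀ x, 0 ≤ b x ^ r * |rieszPotential α f x| ^ r := fun x =>
    mul_nonneg (Real.rpow_nonneg (hb x) r) (Real.rpow_nonneg (abs_nonneg _) r)
  have hle : ∫⁻ x, ENNReal.ofReal (b x ^ r * |rieszPotential α f x| ^ r) ≤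
      ENNReal.ofReal (N * A ^ r * ∫ x, |f x| ^ r) := by
    refine le_trans (lintegral_mono fun x => ?_) hmain
    rw [ENNReal.ofReal_mul (Real.rpow_nonneg (hb x) r),
      ← ENNReal.ofReal_rpow_of_nonneg (hb x) hr0.le,
      ← ENNReal.ofReal_rpow_of_nonneg (abs_nonneg _) hr0.le, ← Real.enorm_eq_ofReal_abs]
    gcongr
    exact enorm_integral_le_lintegral_enorm _
  refine ⟨?_, ?_, ?_⟩
  · filter_upwards [ae_lt_top' hbP (ne_top_of_le_ne_top ENNReal.ofReal_ne_top hmain)] with x hx hbx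
    have hbx' : ENNReal.ofReal (b x) ^ r ≠ 0 := by
      have : 0 < ENNReal.ofReal (b x) := ENNReal.ofReal_pos.2 ((hb x).lt_of_ne' hbx)
      exact (ENNReal.rpow_pos this ENNReal.ofReal_ne_top).ne'
    refine ⟨?_, ?_⟩
    · exact (hunc.comp measurable_prodMk_left).aestronglyMeasurable.congr
        (rieszIntegrand_ae_congr α hff' x).symm
    · refine lt_top_iff_ne_top.2 fun htop => hx.ne ?_
      have hPt : P x = ∞ := htop
      rw [hPt, ENNReal.top_rpow_of_pos hr0, ENNReal.mul_top hbx']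
  · refine ⟨hmeas, ?_⟩
    rw [hasFiniteIntegral_iff_ofReal (Eventually.of_forall hnn)]
    exact hle.trans_lt ENNReal.ofReal_lt_top
  · rw [integral_eq_lintegral_of_nonneg_ae (Eventually.of_forall hnn) hmeas]
    exact ENNReal.toReal_le_of_le_ofReal (by positivity) hle
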